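/- Let $n\ge 1$. Let $B_n$ be Artin's braid group on $n$ strands, with generators $\sigma_1,\dots,\sigma_{n-1}$, and let $\mathscr H_n(z)$ be the Hecke algebra, that is, the quotient of the group algebra $\mathbf Z[z][B_n]$ by the relations $\sigma_i-\sigma_i^{-1}=z$ for $1\le i\le n-1$. Braids are also regarded as elements of $\mathscr H_n(z)$. Let $\mathrm{Tr}\colon\mathscr H_n(z)\to\mathbf Z[z,T]$ ($n\ge 1$) be Ocneanu's trace, the unique family of $\mathbf Z[z]$-linear maps, compatible with the standard maps $\mathscr H_n(z)\to\mathscr H_{n+1}(z)$, with $\mathrm{Tr}(1)=1$, $\mathrm{Tr}(xy)=\mathrm{Tr}(yx)$ for $x,y\in\mathscr H_n(z)$, and $\mathrm{Tr}(x\sigma_n)=T\,\mathrm{Tr}(x)$ for $x\in\mathscr H_n(z)$. For $\beta\in B_n$ let \[H_\beta(v,z)=\left(\frac{v^{-1}-v}{z}\right)^{n-1}\mathrm{Tr}(\beta)\bigg|_{T=z/(1-v^2)}\] be the framed Homfly polynomial, and let $\beta^*$ be the braid obtained by reversing the order of the letters $\sigma_i^{\pm1}$ in a word representing $\beta$. The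 right inner product of $\alpha,\beta\in B_n$ is \[\langle\alpha,\beta\rangle_R=(-z)^{n-1}\cdot\bigl(\text{the coefficient of }v^{n-1}\text{ in }H_{\alpha\beta^*}(v,z)\bigr).\] For $\pi\in S_n$ let $\omega_\pi$ be the positive permutation braid of $\pi$: the braid represented by a word in $\sigma_1,\dots,\sigma_{n-1}$ (without inverses) that induces $\pi$ and is of minimal length among such words; equivalently, a positive braid inducing $\pi$ in which any two strands cross at most once. Then $\langle\cdot,\cdot\rangle_R$ extends uniquely to a $\mathbf Z[z]$-bilinear form $\mathscr H_n(z)\times\mathscr H_n(z)\to\mathbf Z[z]$, the set $\mathbf\Omega=\{\omega_\pi\}_{\pi\in S_n}$ is a basis of the $\mathbf Z[z]$-module $\mathscr H_n(z)$, indexed by $S_n$, and this basis is orthonormal with respect to the right inner product: for all $\pi,\kappa\in S_n$, \[\langle\omega_\pi,\omega_\kappa\rangle_R=\begin{cases}1&\text{if }\pi=\kappa,\\0&\text{if }\pi\ne\kappa.\end{cases}\] -/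

import Mathlib

open Polynomial

namespace BraidHecke

/-! ### Artin's braid group

Everything is indexed by `m`, the number of Artin generators; the number of strands is
`n = m + 1 ≥ 1`. The generators `σ_1, …, σ_{n-1}` are indexed by `Fin m`. -/

/-- The Artin relators: `σ_i σ_j = σ_j σ_i` for `|i - j| ≥ 2` and
`σ_i σ_{i+1} σ_i = σ_{i+1} σ_i σ_{i+1}`. -/
def braidRels (m : ℕ) : Set (FreeGroup (Fin m)) :=
  {r | ∃ i j : Fin m, (i : ℕ) + 2 ≤ (j : ℕ) ∧
      r = FreeGroup.of i * FreeGroup.of j * (FreeGroup.of j * FreeGroup.of i)⁻¹} ∪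
  {r | ∃ i j : Fin m, (i : ℕ) + 1 = (j : ℕ) ∧
      r = FreeGroup.of i * FreeGroup.of j * FreeGroup.of i *
        (FreeGroup.of j * FreeGroup.of i * FreeGroup.of j)⁻¹}

/-- Artin's braid group `B_{m+1}` on `m + 1` strands. -/
abbrev BraidGroup (m : ℕ) : Type := PresentedGroup (braidRels m)

/-- The Artin generator `σ_i` of the braid group. -/
def σ {m : ℕ} (i : Fin m) : BraidGroup m := PresentedGroup.of i

theorem σ_comm {m : ℕ} {i j : Fin m} (h : (i : ℕ) + 2 ≤ (j : ℕ)) :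
    σ i * σ j = σ j * σ i := by
  have := PresentedGroup.one_of_mem (rels := braidRels m) (Or.inl ⟨i, j, h, rfl⟩)
  rw [map_mul, map_inv, mul_inv_eq_one] at this
  simp only [map_mul] at this
  exact this

theorem σ_braid {m : ℕ} {i j : Fin m} (h : (i : ℕ) + 1 = (j : ℕ)) :
    σ i * σ j * σ i = σ j * σ i * σ j := by
  have := PresentedGroup.one_of_mem (rels := braidRels m) (Or.inr ⟨i, j, h, rfl⟩)
  rw [map_mul, map_inv, mul_inv_eq_one] at this
  simp only [map_mul] at this
  exact this

/-- The anti-automorphism of the braid group that fixes the generators, as a homomorphism to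
the opposite group. -/
def revHom (m : ℕ) : BraidGroup m →* (BraidGroup m)ᵐᵒᵖ :=
  PresentedGroup.toGroup (f := fun i => MulOpposite.op (σ i)) (by
    rintro r (⟨i, j, h, rfl⟩ | ⟨i, j, h, rfl⟩)
    · rw [map_mul, map_inv, mul_inv_eq_one]
      simp only [map_mul, FreeGroup.lift_apply_of, ← MulOpposite.op_mul, σ_comm h]
    · rw [map_mul, map_inv, mul_inv_eq_one]
      simp only [map_mul, FreeGroup.lift_apply_of, ← MulOpposite.op_mul, ← mul_assoc,
        σ_braid h])

/-- `β*`: the braid obtained by writing the letters (`σ_i` or `σ_i⁻¹`) of a word representing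
`β` in reverse order. -/
def rev {m : ℕ} (β : BraidGroup m) : BraidGroup m := (revHom m β).unop

/-- The standard map `B_{m+1} → B_{m+2}`, `σ_i ↦ σ_i`, adding one trivial strand at the end. -/
def addStrand (m : ℕ) : BraidGroup m →* BraidGroup (m + 1) :=
  PresentedGroup.toGroup (f := fun i => σ i.castSucc) (by
    rintro r (⟨i, j, h, rfl⟩ | ⟨i, j, h, rfl⟩)
    · rw [map_mul, map_inv, mul_inv_eq_one]
      simpa using σ_comm (i := i.castSucc) (j := j.castSucc) (by simpa using h)
    · rw [map_mul, map_inv, mul_inv_eq_one]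
      simpa using σ_braid (i := i.castSucc) (j := j.castSucc) (by simpa using h))

/-! ### Positive permutation braids -/

/-- The permutation of the `m + 1` strand positions given by a positive word: the product of the
adjacent transpositions `(i, i+1)` over its letters. -/
def wordPerm {m : ℕ} (l : List (Fin m)) : Equiv.Perm (Fin (m + 1)) :=
  (l.map fun i => Equiv.swap i.castSucc i.succ).prod

/-- The positive braid given by a positive word. -/
def wordBraid {m : ℕ} (l : List (Fin m)) : BraidGroup m := (l.map σ).prod

/-- `b` is a positive permutation braid of `π`: it is represented by a positive word that induces
`π` and has as few crossings as a positive word inducing `π` can have (equivalently, any two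
strands cross at most once). -/
def IsPositivePermutationBraid {m : ℕ} (π : Equiv.Perm (Fin (m + 1))) (b : BraidGroup m) : Prop :=
  ∃ l : List (Fin m), wordBraid l = b ∧ wordPerm l = π ∧
    ∀ l' : List (Fin m), wordPerm l' = π → l.length ≤ l'.length

theorem exists_isPositivePermutationBraid {m : ℕ} (π : Equiv.Perm (Fin (m + 1))) :
    ∃ b : BraidGroup m, IsPositivePermutationBraid π b := by
  have hne : ∃ l : List (Fin m), wordPerm l = π := by
    have hπ : π ∈ Submonoid.closure
        (Set.range fun i : Fin m => Equiv.swap i.castSucc i.succ) := by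
      rw [Equiv.Perm.mclosure_swap_castSucc_succ]; trivial
    induction hπ using Submonoid.closure_induction with
    | mem x hx => obtain ⟨i, rfl⟩ := hx; exact ⟨[i], by simp [wordPerm]⟩
    | one => exact ⟨[], by simp [wordPerm]⟩
    | mul x y _ _ hx hy =>
      obtain ⟨a, rfl⟩ := hx
      obtain ⟨b, rfl⟩ := hy
      exact ⟨a ++ b, by simp [wordPerm]⟩
  classical
  have hN : ∃ k : ℕ, ∃ l : List (Fin m), wordPerm l = π ∧ l.length = k :=
    hne.elim fun l hl => ⟨l.length, l, hl, rfl⟩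
  obtain ⟨l, hl, hk⟩ := Nat.find_spec hN
  exact ⟨wordBraid l, l, rfl, hl, fun l' h' => hk ▸ Nat.find_min' hN ⟨l', h', rfl⟩⟩

/-! ### The Hecke algebra -/

/-- The Hecke relation `σ_i - σ_i⁻¹ = z` in the group algebra of the braid group over `ℤ[z]`;
the polynomial variable `X` is `z`. -/
inductive HeckeRel (m : ℕ) :
    MonoidAlgebra ℤ[X] (BraidGroup m) → MonoidAlgebra ℤ[X] (BraidGroup m) → Prop
  | skein (i : Fin m) : HeckeRel m
      (MonoidAlgebra.of ℤ[X] (BraidGroup m) (σ i) -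
        MonoidAlgebra.of ℤ[X] (BraidGroup m) (σ i)⁻¹)
      (algebraMap ℤ[X] (MonoidAlgebra ℤ[X] (BraidGroup m)) X)

/-- The Hecke algebra `ℋ_{m+1}(z)` over `ℤ[z]`. -/
abbrev Hecke (m : ℕ) : Type := RingQuot (HeckeRel m)

/-- The natural representation of braids in the Hecke algebra. -/
noncomputable def toHecke {m : ℕ} : BraidGroup m →* Hecke m :=
  ((RingQuot.mkAlgHom ℤ[X] (HeckeRel m) : MonoidAlgebra ℤ[X] (BraidGroup m) →* Hecke m)).comp
    (MonoidAlgebra.of ℤ[X] (BraidGroup m))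

/-! ### Ocneanu's trace and the framed Homfly polynomial -/

/-- The properties that characterize Ocneanu's trace, a compatible family of `ℤ[z]`-linear maps
`ℋ_n(z) → ℤ[z, T] = ℤ[z][T]`. Since the braids span the Hecke algebra, it is the same to state
the last two for all elements of `ℋ_n(z)`. -/
structure IsOcneanuTrace (Tr : ∀ m : ℕ, Hecke m →ₗ[ℤ[X]] ℤ[X][X]) : Prop where
  map_one : ∀ m, Tr m 1 = 1
  map_mul_comm : ∀ m (x y : Hecke m), Tr m (x * y) = Tr m (y * x)
  map_addStrand : ∀ m (β : BraidGroup m), Tr (m + 1) (toHecke (addStrand m β)) = Tr m (toHecke β)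
  markov : ∀ m (β : BraidGroup m),
    Tr (m + 1) (toHecke (addStrand m β * σ (Fin.last m))) = X * Tr m (toHecke β)

open Classical in
/-- Ocneanu's trace `Tr : ℋ_{m+1}(z) → ℤ[z, T]`: the unique family with the characterizing
properties. That there is exactly one is not assumed: the definition gives `0` otherwise. -/
noncomputable def ocneanuTrace (m : ℕ) : Hecke m →ₗ[ℤ[X]] ℤ[X][X] :=
  if h : ∃! Tr : ∀ m : ℕ, Hecke m →ₗ[ℤ[X]] ℤ[X][X], IsOcneanuTrace Tr then h.choose m else 0

/-- The field `ℚ(z)`, as the fraction field of `ℤ[z]`. -/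
abbrev Kz : Type := FractionRing ℤ[X]

/-- The variable `z` in `ℚ(z)`. -/
noncomputable def z : Kz := algebraMap ℤ[X] Kz X

/-- The variable `v` in the field `ℚ(z)((v))` of Laurent series. -/
noncomputable def v : LaurentSeries Kz := HahnSeries.single 1 1

/-- The framed Homfly polynomial
`H_β(v, z) = ((v⁻¹ - v) / z) ^ (n - 1) * Tr(β)` at `T = z / (1 - v²)`, for `n = m + 1`. It is a
Laurent polynomial in `v`; it is formed here in the field `ℚ(z)((v))`, which contains the
Laurent polynomials in `v` and `z`, and in which coefficients of powers of `v` can be read off. -/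
noncomputable def framedHomfly {m : ℕ} (β : BraidGroup m) : LaurentSeries Kz :=
  ((v⁻¹ - v) / HahnSeries.C z) ^ m *
    (ocneanuTrace m (toHecke β)).eval₂
      ((HahnSeries.C : Kz →+* LaurentSeries Kz).comp (algebraMap ℤ[X] Kz))
      (HahnSeries.C z / (1 - v ^ 2))

/-- The right inner product of two braids on `n = m + 1` strands: `(-z) ^ (n - 1)` times the
coefficient of `v ^ (n - 1)` in `H_{αβ*}(v, z)`. -/
noncomputable def rightInner {m : ℕ} (α β : BraidGroup m) : Kz :=
  (-z) ^ m * (framedHomfly (α * rev β)).coeff (m : ℤ)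

/-- `B` is a `ℤ[z]`-bilinear form on the Hecke algebra, with values in `ℤ[z]`, that extends the
right inner product of braids. -/
def ExtendsRightInner {m : ℕ} (B : Hecke m →ₗ[ℤ[X]] Hecke m →ₗ[ℤ[X]] ℤ[X]) : Prop :=
  ∀ α β : BraidGroup m, algebraMap ℤ[X] Kz (B (toHecke α) (toHecke β)) = rightInner α β

end BraidHecke

open BraidHecke

/-! Let `n = m + 1`. If `Tr β = ∑ t_k T^k` with `k ≤ m`, then substituting `T = z / (1 - v²)` gives
`H_β = v^{-m} ∑ t_k z^{k-m} (1 - v²)^{m-k}`. The coefficient of `v^m` can only come from `v^{2m}` in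
`(1 - v²)^{m-k}`, so only `k = 0` contributes, and the sign and power of `z` are cancelled by
`(-z)^m`. Hence the right inner product of `α` and `β` is the constant term in `T` of `Tr(αβ*)`
(`coeff_homfly_term`, `rightInner_eq_tau`).

That constant term is the canonical trace `τ`, the coefficient at the identity in the regular
representation on functions on `S_n`. Each generator acts there by a self-adjoint operator, so
`τ(αβ*)` is the dot product of `α δ_1` and `β δ_1` (`tau_mul_toHecke_rev`). A reduced word for `π`
sends `δ_1` to `δ_π` (`toPermFun_wordBraid`), which is orthonormality. The basis statement follows
because `n!` elements span the algebra, so that `h ↦ h δ_1` is bijective (`toPermFun_bijective`).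

The existence of `Tr` and the bound on its degree in `T` come from the explicit formula `Tr h = ∑
τ(h e_k) T^k`, where `e_k` is the `k`-th elementary symmetric polynomial in the Jucys–Murphy
elements. The `e_k` are central (`commute_jmSymm`), which makes `Tr` a trace; their recursion in `n`
gives the Markov property (`isOcneanuTrace_jmTrace`). Uniqueness rests on `ℋ_{n+1} = ℋ_n + ℋ_n σ_n
ℋ_n`. -/

namespace BraidHecke

/-! ### Generators and universal property of the Hecke algebra -/

/-- The generator `σ_i`, viewed in the Hecke algebra. -/
noncomputable def gen {m : ℕ} (i : Fin m) : Hecke m := toHecke (σ i)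

theorem toHecke_apply {m : ℕ} (β : BraidGroup m) :
    toHecke β = RingQuot.mkAlgHom ℤ[X] (HeckeRel m) (MonoidAlgebra.of ℤ[X] (BraidGroup m) β) :=
  rfl

theorem gen_eq_toHecke_inv_add {m : ℕ} (i : Fin m) :
    gen i = toHecke (σ i)⁻¹ + algebraMap ℤ[X] (Hecke m) X := by
  have h := RingQuot.mkAlgHom_rel ℤ[X] (HeckeRel.skein i)
  rw [AlgHom.commutes] at h
  rw [← h, gen, toHecke_apply, toHecke_apply, ← map_add, add_sub_cancel]

theorem gen_mul_self {m : ℕ} (i : Fin m) :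
    gen i * gen i = 1 + (X : ℤ[X]) • gen i := by
  nth_rw 1 [gen_eq_toHecke_inv_add i]
  rw [add_mul, ← Algebra.smul_def]
  congr 1
  rw [gen, ← map_mul, inv_mul_cancel, map_one]

theorem gen_comm {m : ℕ} {i j : Fin m} (h : (i : ℕ) + 2 ≤ (j : ℕ)) :
    gen i * gen j = gen j * gen i := by
  simp only [gen, ← map_mul, σ_comm h]

theorem gen_braid {m : ℕ} {i j : Fin m} (h : (i : ℕ) + 1 = (j : ℕ)) :
    gen i * gen j * gen i = gen j * gen i * gen j := by
  simp only [gen, ← map_mul, σ_braid h]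

theorem braid_induction {m : ℕ} {p : BraidGroup m → Prop} (hone : p 1) (hσ : ∀ i, p (σ i))
    (hmul : ∀ a b, p a → p b → p (a * b)) (hinv : ∀ a, p a → p a⁻¹) (β : BraidGroup m) : p β := by
  have hβ : β ∈ Subgroup.closure (Set.range (PresentedGroup.of (rels := braidRels m))) := by
    rw [PresentedGroup.closure_range_of]; trivial
  induction hβ using Subgroup.closure_induction with
  | mem x hx => obtain ⟨i, rfl⟩ := hx; exact hσ i
  | one => exact hone
  | mul a b _ _ ha hb => exact hmul a b ha hb
  | inv a _ ha => exact hinv a ha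

/-- The Hecke algebra is spanned by braids. -/
theorem hecke_induction {m : ℕ} {p : Hecke m → Prop} (hβ : ∀ β, p (toHecke β))
    (hadd : ∀ a b, p a → p b → p (a + b)) (hsmul : ∀ (r : ℤ[X]) a, p a → p (r • a))
    (h : Hecke m) : p h := by
  obtain ⟨x, rfl⟩ := RingQuot.mkAlgHom_surjective ℤ[X] (HeckeRel m) h
  induction x using MonoidAlgebra.induction_on with
  | of β => exact hβ β
  | add x y hx hy => rw [map_add]; exact hadd _ _ hx hy
  | smul r x hx => rw [map_smul]; exact hsmul _ _ hx

theorem adjoin_gen (m : ℕ) : Algebra.adjoin ℤ[X] (Set.range (gen (m := m))) = ⊤ := by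
  have hg : ∀ i : Fin m, gen i ∈ Algebra.adjoin ℤ[X] (Set.range (gen (m := m))) :=
    fun i => Algebra.subset_adjoin ⟨i, rfl⟩
  have hβ : ∀ β : BraidGroup m, toHecke β ∈ Algebra.adjoin ℤ[X] (Set.range (gen (m := m))) ∧
      toHecke β⁻¹ ∈ Algebra.adjoin ℤ[X] (Set.range (gen (m := m))) := by
    refine braid_induction ?_ (fun i => ⟨hg i, ?_⟩) (fun a b ha hb => ?_) (fun a ha => ?_)
    · rw [inv_one, map_one]; exact ⟨one_mem _, one_mem _⟩
    · have h : toHecke (σ i)⁻¹ = gen i + algebraMap ℤ[X] (Hecke m) (-X) := by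
        rw [gen_eq_toHecke_inv_add, add_assoc, ← map_add, add_neg_cancel, map_zero, add_zero]
      rw [h]; exact add_mem (hg i) (Subalgebra.algebraMap_mem _ _)
    · rw [mul_inv_rev, map_mul, map_mul]
      exact ⟨mul_mem ha.1 hb.1, mul_mem hb.2 ha.2⟩
    · rw [inv_inv]; exact ha.symm
  exact Algebra.eq_top_iff.2 fun h => hecke_induction (fun β => (hβ β).1)
    (fun _ _ => add_mem) (fun r _ ha => Subalgebra.smul_mem _ ha r) h

/-- Induction on elements of the Hecke algebra, through products of generators. -/
theorem hecke_gen_induction {m : ℕ} {p : Hecke m → Prop} (hg : ∀ i, p (gen i))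
    (halg : ∀ r, p (algebraMap ℤ[X] _ r)) (hadd : ∀ a b, p a → p b → p (a + b))
    (hmul : ∀ a b, p a → p b → p (a * b)) (h : Hecke m) : p h := by
  have hh : h ∈ Algebra.adjoin ℤ[X] (Set.range (gen (m := m))) := by
    rw [adjoin_gen]; trivial
  induction hh using Algebra.adjoin_induction with
  | mem x hx => obtain ⟨i, rfl⟩ := hx; exact hg i
  | algebraMap r => exact halg r
  | add a b _ _ ha hb => exact hadd a b ha hb
  | mul a b _ _ ha hb => exact hmul a b ha hb

theorem commute_of_commute_gen {m : ℕ} {A : Type*} [Semiring A] [Algebra ℤ[X] A]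
    (f : Hecke m →ₐ[ℤ[X]] A) (c : A) (hg : ∀ i, Commute (f (gen i)) c) (h : Hecke m) :
    Commute (f h) c := by
  refine hecke_gen_induction (p := fun h => Commute (f h) c) hg (fun r => ?_)
    (fun a b ha hb => ?_) (fun a b ha hb => ?_) h
  · rw [AlgHom.commutes]; exact Algebra.commute_algebraMap_left _ _
  · rw [map_add]; exact ha.add_left hb
  · rw [map_mul]; exact ha.mul_left hb

/-- The algebra homomorphism on the Hecke algebra that is induced by a representation of the
braid group which satisfies the skein relation. -/
noncomputable def heckeLift {m : ℕ} {A : Type*} [Semiring A] [Algebra ℤ[X] A] (f : BraidGroup m →* A)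
    (hf : ∀ i, f (σ i) = f (σ i)⁻¹ + algebraMap ℤ[X] A X) : Hecke m →ₐ[ℤ[X]] A :=
  RingQuot.liftAlgHom ℤ[X] ⟨MonoidAlgebra.lift ℤ[X] A (BraidGroup m) f, by
    rintro _ _ ⟨i⟩
    rw [AlgHom.commutes, sub_eq_add_neg, ← neg_one_smul ℤ[X], map_add, map_smul,
      MonoidAlgebra.lift_of, MonoidAlgebra.lift_of, hf, add_right_comm]
    nth_rw 1 [← one_smul ℤ[X] (f (σ i)⁻¹)]
    rw [← add_smul, add_neg_cancel, zero_smul, zero_add]⟩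

theorem heckeLift_toHecke {m : ℕ} {A : Type*} [Semiring A] [Algebra ℤ[X] A] (f : BraidGroup m →* A)
    (hf : ∀ i, f (σ i) = f (σ i)⁻¹ + algebraMap ℤ[X] A X) (β : BraidGroup m) :
    heckeLift f hf (toHecke β) = f β := by
  rw [heckeLift, toHecke_apply, RingQuot.liftAlgHom_mkAlgHom_apply, MonoidAlgebra.lift_of]

theorem addStrand_σ {m : ℕ} (i : Fin m) : addStrand m (σ i) = σ i.castSucc :=
  PresentedGroup.toGroup.of _

/-- The standard map `ℋ_{m+1} → ℋ_{m+2}`. -/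
noncomputable def incl (m : ℕ) : Hecke m →ₐ[ℤ[X]] Hecke (m + 1) :=
  heckeLift (toHecke.comp (addStrand m)) fun i => by
    rw [MonoidHom.comp_apply, MonoidHom.comp_apply, map_inv, addStrand_σ]
    exact gen_eq_toHecke_inv_add _

theorem incl_toHecke {m : ℕ} (β : BraidGroup m) :
    incl m (toHecke β) = toHecke (addStrand m β) :=
  heckeLift_toHecke _ _ _

theorem incl_gen {m : ℕ} (i : Fin m) : incl m (gen i) = gen i.castSucc := by
  rw [gen, incl_toHecke, addStrand_σ, gen]

theorem commute_incl_incl_gen_last {m : ℕ} (h : Hecke m) :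
    Commute (incl (m + 1) (incl m h)) (gen (Fin.last (m + 1))) := by
  refine commute_of_commute_gen ((incl (m + 1)).comp (incl m)) _ (fun i => ?_) h
  rw [AlgHom.comp_apply, incl_gen, incl_gen]
  exact gen_comm (by simp)

/-! ### The regular representation -/

section Action

variable {m : ℕ}

/-- Functions on the symmetric group, the underlying module of the regular representation. -/
abbrev PermFun (m : ℕ) : Type := Equiv.Perm (Fin (m + 1)) → ℤ[X]

/-- The operator by which a crossing of the strands `x`, `y` acts on the left. -/
noncomputable def leftAct (x y : Fin (m + 1)) : PermFun m →ₗ[ℤ[X]] PermFun m where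
  toFun f w := f (Equiv.swap x y * w) + if w⁻¹ y < w⁻¹ x then X * f w else 0
  map_add' f g := by
    ext1 w; simp only [Pi.add_apply]; split_ifs <;> ring
  map_smul' r f := by
    ext1 w; simp only [Pi.smul_apply, smul_eq_mul, RingHom.id_apply]; split_ifs <;> ring

/-- The operator by which a crossing of the strands `x`, `y` acts on the right. -/
noncomputable def rightAct (x y : Fin (m + 1)) : PermFun m →ₗ[ℤ[X]] PermFun m where
  toFun f w := f (w * Equiv.swap x y) + if w y < w x then X * f w else 0
  map_add' f g := by
    ext1 w; simp only [Pi.add_apply]; split_ifs <;> ring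
  map_smul' r f := by
    ext1 w; simp only [Pi.smul_apply, smul_eq_mul, RingHom.id_apply]; split_ifs <;> ring

theorem leftAct_apply (x y : Fin (m + 1)) (f : PermFun m) (w : Equiv.Perm (Fin (m + 1))) :
    leftAct x y f w = f (Equiv.swap x y * w) + if w⁻¹ y < w⁻¹ x then X * f w else 0 := rfl

theorem rightAct_apply (x y : Fin (m + 1)) (f : PermFun m) (w : Equiv.Perm (Fin (m + 1))) :
    rightAct x y f w = f (w * Equiv.swap x y) + if w y < w x then X * f w else 0 := rfl

/-- Left multiplication by the transposition exchanges the positions of `x` and `y`, so exactly one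
of `w` and its translate carries the `X` term. -/
theorem leftAct_leftAct {x y : Fin (m + 1)} (h : x ≠ y) (f : PermFun m) :
    leftAct x y (leftAct x y f) = f + (X : ℤ[X]) • leftAct x y f := by
  ext1 w
  have hne : w⁻¹ x ≠ w⁻¹ y := w⁻¹.injective.ne h
  simp only [leftAct_apply, Pi.add_apply, Pi.smul_apply, smul_eq_mul, mul_inv_rev,
    Equiv.Perm.mul_apply, Equiv.swap_inv, Equiv.swap_apply_left, Equiv.swap_apply_right,
    Equiv.swap_mul_self_mul]
  rcases lt_or_gt_of_ne hne with h1 | h1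
  · simp only [h1, h1.not_gt, if_true, if_false]; ring
  · simp only [h1, h1.not_gt, if_true, if_false]; ring

theorem leftAct_comm {x y x' y' : Fin (m + 1)} (h1 : x ≠ x') (h2 : x ≠ y') (h3 : y ≠ x')
    (h4 : y ≠ y') (f : PermFun m) :
    leftAct x y (leftAct x' y' f) = leftAct x' y' (leftAct x y f) := by
  ext1 w
  have hc : Equiv.swap x y * (Equiv.swap x' y' * w) = Equiv.swap x' y' * (Equiv.swap x y * w) := by
    rw [← mul_assoc, ← mul_assoc]
    congr 1
    ext1 a
    simp only [Equiv.Perm.mul_apply, Equiv.swap_apply_def]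
    split_ifs <;> simp_all
  simp only [leftAct_apply, mul_inv_rev, Equiv.Perm.mul_apply, Equiv.swap_inv, hc,
    Equiv.swap_apply_of_ne_of_ne h1 h2, Equiv.swap_apply_of_ne_of_ne h3 h4,
    Equiv.swap_apply_of_ne_of_ne h1.symm h3.symm, Equiv.swap_apply_of_ne_of_ne h2.symm h4.symm]
  split_ifs <;> ring

/-- At `w` both sides depend, apart from values of `f`, only on the relative order of the positions
of `x`, `y`, `z`; each of the six orders is a polynomial identity. -/
theorem leftAct_braid {x y z : Fin (m + 1)} (h1 : x ≠ y) (h2 : y ≠ z) (h3 : x ≠ z)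
    (f : PermFun m) :
    leftAct x y (leftAct y z (leftAct x y f)) = leftAct y z (leftAct x y (leftAct y z f)) := by
  ext1 w
  have hb : Equiv.swap x y * (Equiv.swap y z * (Equiv.swap x y * w)) =
      Equiv.swap y z * (Equiv.swap x y * (Equiv.swap y z * w)) := by
    simp only [← mul_assoc]
    congr 1
    ext1 a
    simp only [Equiv.Perm.mul_apply, Equiv.swap_apply_def]
    split_ifs <;> simp_all
  have hxy : w⁻¹ x ≠ w⁻¹ y := w⁻¹.injective.ne h1
  have hyz : w⁻¹ y ≠ w⁻¹ z := w⁻¹.injective.ne h2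
  have hxz : w⁻¹ x ≠ w⁻¹ z := w⁻¹.injective.ne h3
  simp only [leftAct_apply, mul_inv_rev, Equiv.Perm.mul_apply, Equiv.swap_inv, hb,
    Equiv.swap_apply_left, Equiv.swap_apply_right, Equiv.swap_mul_self_mul,
    Equiv.swap_apply_of_ne_of_ne h1 h3, Equiv.swap_apply_of_ne_of_ne h3.symm h2.symm]
  generalize w⁻¹ x = p at *
  generalize w⁻¹ y = q at *
  generalize w⁻¹ z = r at *
  rcases lt_or_gt_of_ne hxy with a | a <;> rcases lt_or_gt_of_ne hyz with b | b <;>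
    rcases lt_or_gt_of_ne hxz with c | c <;>
    first
    | (exfalso; order)
    | (simp only [a, b, c, a.not_gt, b.not_gt, c.not_gt, if_true, if_false] <;> ring)

theorem swap_lt_swap_iff (i : Fin m) {p q : Fin (m + 1)}
    (h1 : ¬(p = i.castSucc ∧ q = i.succ)) (h2 : ¬(q = i.castSucc ∧ p = i.succ)) :
    Equiv.swap i.castSucc i.succ p < Equiv.swap i.castSucc i.succ q ↔ p < q := by
  simp only [Equiv.swap_apply_def, Fin.ext_iff, Fin.lt_def] at *
  simp only [Fin.val_castSucc, Fin.val_succ] at *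
  split_ifs <;> (try simp only [Fin.val_castSucc, Fin.val_succ]) <;> omega

/-- The inversion test on one side is unaffected by the adjacent transposition on the other, unless
the two transpositions move `w` to the same permutation; in that case the two operators agree at
both permutations involved. -/
theorem leftAct_rightAct_comm (i j : Fin m) (f : PermFun m) :
    leftAct i.castSucc i.succ (rightAct j.castSucc j.succ f) =
      rightAct j.castSucc j.succ (leftAct i.castSucc i.succ f) := by
  ext1 w
  have hi : i.castSucc < i.succ := Fin.castSucc_lt_succ
  have hj : j.castSucc < j.succ := Fin.castSucc_lt_succ
  simp only [leftAct_apply, rightAct_apply, mul_inv_rev, Equiv.Perm.mul_apply, Equiv.swap_inv,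
    mul_assoc]
  by_cases h1 : w j.castSucc = i.castSucc ∧ w j.succ = i.succ
  · have e : Equiv.swap i.castSucc i.succ * w = w * Equiv.swap j.castSucc j.succ := by
      rw [← h1.1, ← h1.2, Equiv.mul_swap_eq_swap_mul]
    have e1 : w⁻¹ i.castSucc = j.castSucc := Equiv.Perm.inv_eq_iff_eq.2 h1.1.symm
    have e2 : w⁻¹ i.succ = j.succ := Equiv.Perm.inv_eq_iff_eq.2 h1.2.symm
    simp only [h1.1, h1.2, e1, e2, Equiv.swap_apply_left, Equiv.swap_apply_right, hi, hj,
      hi.not_gt, hj.not_gt, if_true, if_false, e]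
  by_cases h2 : w j.succ = i.castSucc ∧ w j.castSucc = i.succ
  · have e : Equiv.swap i.castSucc i.succ * w = w * Equiv.swap j.castSucc j.succ := by
      rw [← h2.1, ← h2.2, Equiv.mul_swap_eq_swap_mul, Equiv.swap_comm]
    have e1 : w⁻¹ i.castSucc = j.succ := Equiv.Perm.inv_eq_iff_eq.2 h2.1.symm
    have e2 : w⁻¹ i.succ = j.castSucc := Equiv.Perm.inv_eq_iff_eq.2 h2.2.symm
    simp only [h2.1, h2.2, e1, e2, Equiv.swap_apply_left, Equiv.swap_apply_right, hi, hj,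
      hi.not_gt, hj.not_gt, if_true, if_false, e]
  have k1 := swap_lt_swap_iff i h2 h1
  have k2 := swap_lt_swap_iff j (p := w⁻¹ i.succ) (q := w⁻¹ i.castSucc)
    (fun h => h2 ⟨(Equiv.Perm.inv_eq_iff_eq.1 h.2).symm, (Equiv.Perm.inv_eq_iff_eq.1 h.1).symm⟩)
    (fun h => h1 ⟨(Equiv.Perm.inv_eq_iff_eq.1 h.1).symm, (Equiv.Perm.inv_eq_iff_eq.1 h.2).symm⟩)
  simp only [k1, k2]
  split_ifs <;> ring

/-- Translation by an involution is self-adjoint, and the remaining term is a diagonal operator. -/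
theorem leftAct_dotProduct (x y : Fin (m + 1)) (f g : PermFun m) :
    leftAct x y f ⬝ᵥ g = f ⬝ᵥ leftAct x y g := by
  simp only [dotProduct, leftAct_apply, add_mul, mul_add, Finset.sum_add_distrib]
  congr 1
  · refine Fintype.sum_equiv (Equiv.mulLeft (Equiv.swap x y)) _ _ fun w => ?_
    simp only [Equiv.coe_mulLeft, Equiv.swap_mul_self_mul]
  · refine Finset.sum_congr rfl fun w _ => ?_
    split_ifs <;> ring

theorem rightAct_dotProduct (x y : Fin (m + 1)) (f g : PermFun m) :
    rightAct x y f ⬝ᵥ g = f ⬝ᵥ rightAct x y g := by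
  simp only [dotProduct, rightAct_apply, add_mul, mul_add, Finset.sum_add_distrib]
  congr 1
  · refine Fintype.sum_equiv (Equiv.mulRight (Equiv.swap x y)) _ _ fun w => ?_
    simp only [Equiv.coe_mulRight, Equiv.mul_swap_mul_self]
  · refine Finset.sum_congr rfl fun w _ => ?_
    split_ifs <;> ring

end Action

/-- The invertible operator by which a generator of the braid group acts. -/
noncomputable def genAct {m : ℕ} (i : Fin m) : (Module.End ℤ[X] (PermFun m))ˣ where
  val := leftAct i.castSucc i.succ
  inv := leftAct i.castSucc i.succ - (X : ℤ[X]) • 1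
  val_inv := LinearMap.ext fun f => by
    simp [mul_sub, leftAct_leftAct (Fin.castSucc_lt_succ (i := i)).ne]
  inv_val := LinearMap.ext fun f => by
    simp [sub_mul, leftAct_leftAct (Fin.castSucc_lt_succ (i := i)).ne]

/-- The action of the braid group on functions on the symmetric group. -/
noncomputable def braidAct (m : ℕ) : BraidGroup m →* (Module.End ℤ[X] (PermFun m))ˣ :=
  PresentedGroup.toGroup (f := genAct) (by
    rintro r (⟨i, j, h, rfl⟩ | ⟨i, j, h, rfl⟩)
    · rw [map_mul, map_inv, mul_inv_eq_one]
      simp only [map_mul, FreeGroup.lift_apply_of]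
      refine Units.ext (LinearMap.ext fun f => leftAct_comm ?_ ?_ ?_ ?_ f) <;>
        simp only [ne_eq, Fin.ext_iff, Fin.val_castSucc, Fin.val_succ] <;> omega
    · rw [map_mul, map_inv, mul_inv_eq_one]
      simp only [map_mul, FreeGroup.lift_apply_of]
      have hj : j.castSucc = i.succ := Fin.ext (by simp [← h])
      refine Units.ext (LinearMap.ext fun f => ?_)
      simp only [genAct, Units.val_mul, Module.End.mul_apply, hj]
      refine leftAct_braid ?_ ?_ ?_ f <;>
        simp only [ne_eq, Fin.ext_iff, Fin.val_castSucc, Fin.val_succ] <;> omega)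

theorem braidAct_σ {m : ℕ} (i : Fin m) : braidAct m (σ i) = genAct i :=
  PresentedGroup.toGroup.of _

/-- The regular representation of the Hecke algebra. -/
noncomputable def heckeAct (m : ℕ) : Hecke m →ₐ[ℤ[X]] Module.End ℤ[X] (PermFun m) :=
  heckeLift ((Units.coeHom _).comp (braidAct m)) fun i => by
    rw [MonoidHom.comp_apply, MonoidHom.comp_apply, map_inv, braidAct_σ, Units.coeHom_apply,
      Units.coeHom_apply, Algebra.algebraMap_eq_smul_one]
    exact (sub_add_cancel _ _).symm

theorem heckeAct_gen {m : ℕ} (i : Fin m) :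
    heckeAct m (gen i) = leftAct i.castSucc i.succ := by
  rw [gen, heckeAct, heckeLift_toHecke, MonoidHom.comp_apply, braidAct_σ]
  rfl

theorem heckeAct_mul_apply {m : ℕ} (a b : Hecke m) (f : PermFun m) :
    heckeAct m (a * b) f = heckeAct m a (heckeAct m b f) := by
  rw [map_mul, Module.End.mul_apply]

theorem heckeAct_rightAct {m : ℕ} (h : Hecke m) (j : Fin m) (f : PermFun m) :
    heckeAct m h (rightAct j.castSucc j.succ f) = rightAct j.castSucc j.succ (heckeAct m h f) := by
  have := commute_of_commute_gen (heckeAct m) (rightAct j.castSucc j.succ) (fun i => ?_) h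
  · exact LinearMap.congr_fun this f
  · rw [heckeAct_gen]
    exact LinearMap.ext fun f => leftAct_rightAct_comm i j f

theorem rev_mul {m : ℕ} (a b : BraidGroup m) : rev (a * b) = rev b * rev a := by
  simp [rev]

theorem rev_σ {m : ℕ} (i : Fin m) : rev (σ i) = σ i := by
  rw [rev, revHom, σ, PresentedGroup.toGroup.of, MulOpposite.unop_op, σ]

theorem heckeAct_toHecke_dotProduct {m : ℕ} (β : BraidGroup m) (f g : PermFun m) :
    heckeAct m (toHecke β) f ⬝ᵥ g = f ⬝ᵥ heckeAct m (toHecke (rev β)) g := by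
  revert f g
  refine braid_induction (p := fun β => ∀ f g : PermFun m,
    heckeAct m (toHecke β) f ⬝ᵥ g = f ⬝ᵥ heckeAct m (toHecke (rev β)) g) ?_ ?_ ?_ ?_ β
  · intro f g; simp [rev]
  · intro i f g
    rw [rev_σ, ← gen, heckeAct_gen, leftAct_dotProduct]
  · intro a b ha hb f g
    rw [rev_mul, map_mul toHecke, map_mul toHecke, heckeAct_mul_apply, heckeAct_mul_apply, ha, hb]
  · intro a ha f g
    -- Writing `f` as `a (a⁻¹ f)` lets the hypothesis on `a` move `a` across, where `rev a` cancels
    -- `rev a⁻¹`.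
    have h1 : f = heckeAct m (toHecke a) (heckeAct m (toHecke a⁻¹) f) := by
      rw [← heckeAct_mul_apply, ← map_mul toHecke, mul_inv_cancel]; simp
    have h2 : heckeAct m (toHecke (rev a)) (heckeAct m (toHecke (rev a⁻¹)) g) = g := by
      rw [← heckeAct_mul_apply, ← map_mul toHecke, ← rev_mul, inv_mul_cancel]; simp [rev]
    conv_rhs => rw [h1, ha, h2]

/-- The basis vector of `PermFun m` at `w`. -/
noncomputable def delta {m : ℕ} (w : Equiv.Perm (Fin (m + 1))) : PermFun m := Pi.single w 1

theorem delta_apply {m : ℕ} (w u : Equiv.Perm (Fin (m + 1))) :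
    delta w u = if u = w then 1 else 0 := Pi.single_apply _ _ _

theorem dotProduct_delta {m : ℕ} (f : PermFun m) (w : Equiv.Perm (Fin (m + 1))) :
    f ⬝ᵥ delta w = f w := by
  rw [delta, dotProduct_single, mul_one]

theorem leftAct_delta_of_lt {m : ℕ} {x y : Fin (m + 1)} {w : Equiv.Perm (Fin (m + 1))}
    (h : w⁻¹ x < w⁻¹ y) : leftAct x y (delta w) = delta (Equiv.swap x y * w) := by
  ext1 u
  simp only [leftAct_apply, delta_apply, ← eq_inv_mul_iff_mul_eq, Equiv.swap_inv]
  by_cases hu : u = w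
  · subst hu; simpa using h.le
  · simp [hu]

theorem rightAct_delta_one {m : ℕ} (i : Fin m) :
    rightAct i.castSucc i.succ (delta 1) = delta (Equiv.swap i.castSucc i.succ) := by
  ext1 u
  simp only [rightAct_apply, delta_apply, mul_eq_one_iff_eq_inv, Equiv.swap_inv]
  by_cases hu : u = 1
  · subst hu; simp [(Fin.castSucc_lt_succ (i := i)).not_gt]
  · simp [hu]

/-! ### The canonical trace -/

/-- The linear map `h ↦ h • δ_1` from the Hecke algebra to its regular representation. -/
noncomputable def toPermFun (m : ℕ) : Hecke m →ₗ[ℤ[X]] PermFun m :=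
  (LinearMap.applyₗ (delta 1)).comp (heckeAct m).toLinearMap

theorem toPermFun_apply {m : ℕ} (h : Hecke m) : toPermFun m h = heckeAct m h (delta 1) := rfl

theorem toPermFun_mul {m : ℕ} (a b : Hecke m) :
    toPermFun m (a * b) = heckeAct m a (toPermFun m b) := heckeAct_mul_apply _ _ _

theorem toPermFun_one (m : ℕ) : toPermFun m 1 = delta 1 := by
  rw [toPermFun_apply, map_one, Module.End.one_apply]

/-- The canonical trace of the Hecke algebra: the coefficient at the identity. -/
noncomputable def tau (m : ℕ) : Hecke m →ₗ[ℤ[X]] ℤ[X] :=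
  (LinearMap.proj 1).comp (toPermFun m)

theorem tau_apply {m : ℕ} (h : Hecke m) : tau m h = toPermFun m h 1 := rfl

theorem tau_eq_dotProduct {m : ℕ} (h : Hecke m) : tau m h = toPermFun m h ⬝ᵥ delta 1 := by
  rw [dotProduct_delta, tau_apply]

theorem tau_one (m : ℕ) : tau m 1 = 1 := by
  rw [tau_apply, toPermFun_one, delta_apply, if_pos rfl]

/-- On `δ_1` the left and right actions of a generator agree. The right action commutes with `h` and
is self-adjoint, so the generator can be carried around to the other side of `h`. -/
theorem tau_mul_gen {m : ℕ} (h : Hecke m) (i : Fin m) : tau m (h * gen i) = tau m (gen i * h) := by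
  have h1 : toPermFun m (gen i) = rightAct i.castSucc i.succ (delta 1) := by
    rw [toPermFun_apply, heckeAct_gen, rightAct_delta_one, leftAct_delta_of_lt, mul_one]
    simp
  rw [tau_eq_dotProduct, tau_eq_dotProduct, toPermFun_mul, toPermFun_mul, h1, heckeAct_rightAct,
    heckeAct_gen, rightAct_dotProduct, leftAct_dotProduct, ← h1,
    toPermFun_apply, toPermFun_apply, heckeAct_gen]

theorem tau_mul_comm {m : ℕ} (a b : Hecke m) : tau m (a * b) = tau m (b * a) := by
  revert a
  refine hecke_gen_induction (p := fun b => ∀ a, tau m (a * b) = tau m (b * a)) ?_ ?_ ?_ ?_ b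
  · exact fun i a => tau_mul_gen a i
  · intro r a; rw [Algebra.commutes]
  · intro b c hb hc a; rw [mul_add, add_mul, map_add, map_add, hb, hc]
  · intro b c hb hc a
    rw [← mul_assoc, hc, ← mul_assoc, hb, mul_assoc]

/-- This turns the trace form into the standard dot product: by cyclicity `rev β` acts first from
the left, and its adjoint is `β`. -/
theorem tau_mul_toHecke_rev {m : ℕ} (h : Hecke m) (β : BraidGroup m) :
    tau m (h * toHecke (rev β)) = toPermFun m h ⬝ᵥ toPermFun m (toHecke β) := by
  rw [tau_mul_comm, tau_apply, toPermFun_mul, dotProduct_comm, toPermFun_apply (toHecke β),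
    heckeAct_toHecke_dotProduct, dotProduct_comm, dotProduct_delta]

/-! ### Restriction to a smaller symmetric group -/

/-- The extension of a permutation by a fixed last point. -/
def permExt {m : ℕ} (u : Equiv.Perm (Fin (m + 1))) : Equiv.Perm (Fin (m + 2)) :=
  finSuccEquivLast.symm.permCongr (Equiv.optionCongr u)

theorem permExt_castSucc {m : ℕ} (u : Equiv.Perm (Fin (m + 1))) (a : Fin (m + 1)) :
    permExt u a.castSucc = (u a).castSucc := by
  simp [permExt, Equiv.permCongr_apply]

theorem permExt_last {m : ℕ} (u : Equiv.Perm (Fin (m + 1))) :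
    permExt u (Fin.last (m + 1)) = Fin.last (m + 1) := by
  simp [permExt, Equiv.permCongr_apply]

theorem permExt_inv_castSucc {m : ℕ} (u : Equiv.Perm (Fin (m + 1))) (a : Fin (m + 1)) :
    (permExt u)⁻¹ a.castSucc = (u⁻¹ a).castSucc := by
  rw [Equiv.Perm.inv_eq_iff_eq, permExt_castSucc]
  simp

theorem permExt_injective {m : ℕ} : Function.Injective (permExt (m := m)) := fun u w h =>
  Equiv.ext fun a => Fin.castSucc_injective _ <| by
    rw [← permExt_castSucc, ← permExt_castSucc, h]

theorem permExt_one (m : ℕ) : permExt (1 : Equiv.Perm (Fin (m + 1))) = 1 := by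
  ext1 a
  induction a using Fin.lastCases with
  | last => rw [permExt_last]; rfl
  | cast a => rw [permExt_castSucc]; rfl

theorem permExt_swap_mul {m : ℕ} (x y : Fin (m + 1)) (u : Equiv.Perm (Fin (m + 1))) :
    permExt (Equiv.swap x y * u) = Equiv.swap x.castSucc y.castSucc * permExt u := by
  ext1 a
  induction a using Fin.lastCases with
  | last =>
    rw [permExt_last, Equiv.Perm.mul_apply, permExt_last,
      Equiv.swap_apply_of_ne_of_ne (Fin.castSucc_ne_last _).symm (Fin.castSucc_ne_last _).symm]
  | cast a =>
    rw [permExt_castSucc, Equiv.Perm.mul_apply, Equiv.Perm.mul_apply, permExt_castSucc,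
      (Fin.castSucc_injective _).swap_apply]

/-- Restriction of functions to the symmetric group on one letter less. -/
noncomputable def res (m : ℕ) : PermFun (m + 1) →ₗ[ℤ[X]] PermFun m :=
  LinearMap.funLeft ℤ[X] ℤ[X] permExt

theorem res_apply {m : ℕ} (f : PermFun (m + 1)) (u : Equiv.Perm (Fin (m + 1))) :
    res m f u = f (permExt u) := rfl

/-- The generators of the smaller algebra preserve the subgroup fixing the last point, and on it the
inversion tests agree. -/
theorem res_heckeAct_incl {m : ℕ} (h : Hecke m) (f : PermFun (m + 1)) :
    res m (heckeAct (m + 1) (incl m h) f) = heckeAct m h (res m f) := by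
  revert f
  refine hecke_gen_induction (p := fun h => ∀ f, res m (heckeAct (m + 1) (incl m h) f) =
    heckeAct m h (res m f)) ?_ ?_ ?_ ?_ h
  · intro i f
    rw [incl_gen, heckeAct_gen, heckeAct_gen, Fin.succ_castSucc]
    ext1 u
    simp only [res_apply, leftAct_apply, permExt_swap_mul, permExt_inv_castSucc,
      Fin.castSucc_lt_castSucc_iff]
  · intro r f
    rw [AlgHom.commutes, AlgHom.commutes, AlgHom.commutes, Module.algebraMap_end_apply,
      Module.algebraMap_end_apply, map_smul]
  · intro a b ha hb f
    rw [map_add, map_add, map_add, LinearMap.add_apply, LinearMap.add_apply, map_add, ha, hb]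
  · intro a b ha hb f
    rw [map_mul, heckeAct_mul_apply, heckeAct_mul_apply, ha, hb]

theorem res_delta_one (m : ℕ) : res m (delta 1) = delta 1 := by
  ext1 u
  rw [res_apply, ← permExt_one, delta_apply, delta_apply]
  simp only [permExt_injective.eq_iff]

theorem tau_eq_res {m : ℕ} (h : Hecke (m + 1)) :
    tau (m + 1) h = res m (toPermFun (m + 1) h) 1 := by
  rw [res_apply, permExt_one, tau_apply]

theorem tau_incl {m : ℕ} (h : Hecke m) : tau (m + 1) (incl m h) = tau m h := by
  rw [tau_eq_res, toPermFun_apply, res_heckeAct_incl, res_delta_one, tau_apply, toPermFun_apply]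

/-- The vector `σ_n δ_1` is supported at a transposition that moves the last point, so it restricts
to zero on the smaller symmetric group. -/
theorem tau_incl_mul_gen_last {m : ℕ} (h : Hecke m) :
    tau (m + 1) (incl m h * gen (Fin.last m)) = 0 := by
  have h1 : res m (toPermFun (m + 1) (gen (Fin.last m))) = 0 := by
    rw [toPermFun_apply, heckeAct_gen, leftAct_delta_of_lt (by simp), mul_one]
    ext1 u
    rw [res_apply, delta_apply, if_neg, Pi.zero_apply]
    intro hu
    have h2 := permExt_last u
    rw [hu, Fin.succ_last, Equiv.swap_apply_right] at h2
    exact Fin.castSucc_ne_last _ h2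
  rw [tau_eq_res, toPermFun_mul, res_heckeAct_incl, h1, map_zero,
    Pi.zero_apply]

/-! ### Words of minimal length -/

theorem wordPerm_cons {m : ℕ} (i : Fin m) (l : List (Fin m)) :
    wordPerm (i :: l) = Equiv.swap i.castSucc i.succ * wordPerm l := by
  simp [wordPerm]

/-- The exchange property: an inversion of a word can be removed by deleting one letter. -/
theorem exists_wordPerm_eq_swap_mul {m : ℕ} (l : List (Fin m)) {x y : Fin (m + 1)} (hxy : x < y)
    (h : (wordPerm l)⁻¹ y < (wordPerm l)⁻¹ x) :
    ∃ l' : List (Fin m), l'.length + 1 = l.length ∧ wordPerm l' = Equiv.swap x y * wordPerm l := by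
  induction l generalizing x y with
  | nil => simp [wordPerm] at h; order
  | cons i l ih =>
    rw [wordPerm_cons] at h ⊢
    by_cases h1 : x = i.castSucc ∧ y = i.succ
    · exact ⟨l, rfl, by rw [h1.1, h1.2, Equiv.swap_mul_self_mul]⟩
    have h2 : ¬(y = i.castSucc ∧ x = i.succ) := by
      rintro ⟨rfl, rfl⟩
      exact absurd hxy Fin.castSucc_lt_succ.not_gt
    rw [mul_inv_rev, Equiv.Perm.mul_apply, Equiv.Perm.mul_apply, Equiv.swap_inv] at h
    obtain ⟨l', hl, hp⟩ := ih ((swap_lt_swap_iff i h1 h2).2 hxy) h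
    refine ⟨i :: l', by simp [hl], ?_⟩
    rw [wordPerm_cons, hp, ← mul_assoc, Equiv.mul_swap_eq_swap_mul, Equiv.swap_apply_self,
      Equiv.swap_apply_self, mul_assoc]

theorem wordBraid_cons {m : ℕ} (i : Fin m) (l : List (Fin m)) :
    wordBraid (i :: l) = σ i * wordBraid l := by
  simp [wordBraid]

theorem toPermFun_wordBraid {m : ℕ} (l : List (Fin m))
    (hl : ∀ l' : List (Fin m), wordPerm l' = wordPerm l → l.length ≤ l'.length) :
    toPermFun m (toHecke (wordBraid l)) = delta (wordPerm l) := by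
  induction l with
  | nil => simp [wordBraid, wordPerm, toPermFun_one]
  | cons i l ih =>
    rw [wordBraid_cons, map_mul, toPermFun_mul, ih, ← gen, heckeAct_gen, wordPerm_cons]
    · refine leftAct_delta_of_lt (lt_of_not_ge fun h => ?_)
      have hne : (wordPerm l)⁻¹ i.succ ≠ (wordPerm l)⁻¹ i.castSucc :=
        (wordPerm l)⁻¹.injective.ne Fin.castSucc_lt_succ.ne'
      obtain ⟨l', h1, h2⟩ := exists_wordPerm_eq_swap_mul l Fin.castSucc_lt_succ (h.lt_of_ne hne)
      have := hl l' (by rw [h2, wordPerm_cons])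
      rw [List.length_cons] at this
      omega
    · intro l' h'
      have := hl (i :: l') (by rw [wordPerm_cons, wordPerm_cons, h'])
      simpa using this

theorem toPermFun_of_isPositivePermutationBraid {m : ℕ} {π : Equiv.Perm (Fin (m + 1))}
    {b : BraidGroup m} (h : IsPositivePermutationBraid π b) :
    toPermFun m (toHecke b) = delta π := by
  obtain ⟨l, rfl, rfl, hl⟩ := h
  exact toPermFun_wordBraid l hl

/-! ### Jucys–Murphy elements -/

/-- The Jucys–Murphy element: the sum of the positive permutation braids of the transpositions
that move the last strand. -/
noncomputable def jucysMurphy : ∀ m : ℕ, Hecke m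
  | 0 => 0
  | m + 1 => gen (Fin.last m) * incl m (jucysMurphy m) * gen (Fin.last m) + gen (Fin.last m)

theorem jucysMurphy_succ (m : ℕ) : jucysMurphy (m + 1) =
    gen (Fin.last m) * incl m (jucysMurphy m) * gen (Fin.last m) + gen (Fin.last m) := by
  rw [jucysMurphy]

theorem jucysMurphy_one : jucysMurphy 1 = gen (Fin.last 0) := by
  rw [jucysMurphy_succ, jucysMurphy, map_zero, mul_zero, zero_mul]
  exact zero_add _

section Identities

variable {R A : Type*} [CommSemiring R] [Semiring A] [Algebra R A] {r : R} {a b l : A}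

/-- Used with `a = σ_{n-1}`, `b = σ_n` and `l` an earlier Jucys–Murphy element. The braid relation
carries `a` through the long term; the other two terms produce the same correction `r • (b * a * b)`
on both sides. -/
theorem commute_of_braid (hb : b * b = 1 + r • b) (hab : a * b * a = b * a * b)
    (hl : Commute b l) : Commute a (b * (a * l * a + a) * b + b) := by
  have h1 : a * (b * (a * l * a) * b) = b * (a * l * a) * b * a := calc
    _ = a * b * a * l * a * b := by simp only [mul_assoc]
    _ = b * a * (b * l) * a * b := by rw [hab]; simp only [mul_assoc]
    _ = b * a * l * (b * a * b) := by rw [hl.eq]; simp only [mul_assoc]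
    _ = _ := by rw [← hab]; simp only [mul_assoc]
  have h2 : a * (b * a * b) = b * a + r • (b * a * b) := calc
    _ = a * b * a * b := by simp only [mul_assoc]
    _ = b * a * (b * b) := by rw [hab]; simp only [mul_assoc]
    _ = _ := by rw [hb, mul_add, mul_one, mul_smul_comm]
  have h3 : b * a * b * a = a * b + r • (b * a * b) := calc
    _ = b * (a * b * a) := by simp only [mul_assoc]
    _ = b * b * a * b := by rw [hab]; simp only [mul_assoc]
    _ = _ := by rw [hb, add_mul, add_mul, one_mul, smul_mul_assoc, smul_mul_assoc]
  rw [commute_iff_eq, mul_add b, add_mul _ _ b, mul_add a, mul_add a, add_mul _ _ a,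
    add_mul _ _ a, h1, h2, h3]
  abel

/-- Here `l` and `b * l * b + b` play consecutive Jucys–Murphy elements. With
`commute_mul_of_commute`, `b` commutes with their sum and product, hence with their symmetric
polynomials. -/
theorem commute_add_of_mul_self (hb : b * b = 1 + r • b) : Commute b (l + (b * l * b + b)) := by
  have h1 : b * (b * l * b) = l * b + r • (b * l * b) := by
    rw [mul_assoc b l b, ← mul_assoc b b, hb, add_mul, one_mul, smul_mul_assoc]
  have h2 : b * l * b * b = b * l + r • (b * l * b) := by
    rw [mul_assoc, hb, mul_add, mul_one, mul_smul_comm]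
  rw [commute_iff_eq, mul_add, mul_add, add_mul, add_mul, h1, h2]
  abel

theorem commute_mul_of_commute (hl : Commute l (b * l * b + b)) :
    Commute b (l * (b * l * b + b)) := by
  rw [commute_iff_eq]
  nth_rw 2 [hl.eq]
  simp only [mul_add, add_mul, mul_assoc]

end Identities

theorem commute_incl_jucysMurphy {m : ℕ} (h : Hecke m) :
    Commute (incl m h) (jucysMurphy (m + 1)) := by
  induction m with
  | zero => exact commute_of_commute_gen (incl 0) _ (fun i => i.elim0) h
  | succ m ih =>
    refine commute_of_commute_gen (incl (m + 1)) _ (fun i => ?_) h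
    rw [jucysMurphy_succ]
    induction i using Fin.lastCases with
    | last =>
      rw [jucysMurphy_succ, map_add, map_mul, map_mul, incl_gen]
      exact commute_of_braid (gen_mul_self _) (gen_braid (by simp))
        (commute_incl_incl_gen_last _).symm
    | cast i =>
      have h1 : Commute (incl (m + 1) (gen i.castSucc)) (gen (Fin.last (m + 1))) := by
        rw [← incl_gen]; exact commute_incl_incl_gen_last _
      have h2 : Commute (incl (m + 1) (gen i.castSucc)) (incl (m + 1) (jucysMurphy (m + 1))) := by
        rw [← incl_gen]; exact (ih (gen i)).map (incl (m + 1))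
      exact ((h1.mul_right h2).mul_right h1).add_right h1

/-- The elementary symmetric polynomials of the Jucys–Murphy elements. -/
noncomputable def jmSymm : ∀ m : ℕ, ℕ → Hecke m
  | 0, 0 => 1
  | 0, _ + 1 => 0
  | _ + 1, 0 => 1
  | m + 1, k + 1 => incl m (jmSymm m (k + 1)) + incl m (jmSymm m k) * jucysMurphy (m + 1)

theorem jmSymm_zero (m : ℕ) : jmSymm m 0 = 1 := by
  cases m <;> rw [jmSymm]

theorem jmSymm_succ_succ (m k : ℕ) : jmSymm (m + 1) (k + 1) =
    incl m (jmSymm m (k + 1)) + incl m (jmSymm m k) * jucysMurphy (m + 1) := by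
  rw [jmSymm]

theorem jmSymm_of_lt {m k : ℕ} (h : m < k) : jmSymm m k = 0 := by
  induction m generalizing k with
  | zero =>
    obtain ⟨k, rfl⟩ := Nat.exists_eq_succ_of_ne_zero h.ne'
    rw [jmSymm]
  | succ m ih =>
    obtain ⟨k, rfl⟩ := Nat.exists_eq_succ_of_ne_zero (Nat.ne_zero_of_lt h)
    rw [Nat.succ_eq_add_one, jmSymm_succ_succ, ih (by omega), ih (by omega), map_zero, zero_mul,
      add_zero]

/-- Earlier generators are handled by induction and `commute_incl_jucysMurphy`. The last generator
commutes with all but the last two Jucys–Murphy elements, and these enter only through their sum and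
product. -/
theorem commute_jmSymm {m : ℕ} (k : ℕ) (h : Hecke m) : Commute h (jmSymm m k) := by
  induction m generalizing k with
  | zero => exact commute_of_commute_gen (AlgHom.id _ _) _ (fun i => i.elim0) h
  | succ m ih =>
    refine commute_of_commute_gen (AlgHom.id _ _) _ (fun i => ?_) h
    rw [AlgHom.id_apply]
    cases k with
    | zero => rw [jmSymm_zero]; exact Commute.one_right _
    | succ k =>
    rw [jmSymm_succ_succ]
    induction i using Fin.lastCases with
    | cast i =>
      rw [← incl_gen]
      exact ((ih _ _).map (incl m)).add_right
        (((ih _ _).map (incl m)).mul_right (commute_incl_jucysMurphy _))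
    | last =>
      cases m with
      | zero =>
        have h0 : ∀ k, Commute (gen (Fin.last 0)) (incl 0 (jmSymm 0 k))
          | 0 => by rw [jmSymm_zero, map_one]; exact Commute.one_right _
          | k + 1 => by rw [jmSymm_of_lt k.succ_pos, map_zero]; exact Commute.zero_right _
        refine (h0 _).add_right ((h0 _).mul_right ?_)
        rw [jucysMurphy_one]
        exact Commute.refl _
      | succ m =>
        have h1 : Commute (gen (Fin.last (m + 1)))
            (incl (m + 1) (jucysMurphy (m + 1)) + jucysMurphy (m + 2)) := by
          rw [jucysMurphy_succ (m + 1)]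
          exact commute_add_of_mul_self (gen_mul_self _)
        have h2 : Commute (gen (Fin.last (m + 1)))
            (incl (m + 1) (jucysMurphy (m + 1)) * jucysMurphy (m + 2)) := by
          have := commute_incl_jucysMurphy (jucysMurphy (m + 1))
          rw [jucysMurphy_succ (m + 1)] at this ⊢
          exact commute_mul_of_commute this
        have h3 := fun k => (commute_incl_incl_gen_last (jmSymm m k)).symm
        cases k with
        | zero =>
          rw [jmSymm_succ_succ, jmSymm_zero, jmSymm_zero, map_add, map_mul, map_one, map_one,
            one_mul, one_mul, add_assoc (incl _ _)]
          exact (h3 _).add_right h1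
        | succ k =>
          -- Two levels of the recursion give `e_{k+2} + e_{k+1} (L + L') + e_k L L'`, with `L`,
          -- `L'` the last two Jucys–Murphy elements and the `e_j` formed from the earlier ones.
          rw [jmSymm_succ_succ, jmSymm_succ_succ, map_add, map_mul, map_add, map_mul, add_mul,
            add_assoc (incl _ _), ← add_assoc (_ * _) (_ * _) (_ * _), ← mul_add,
            mul_assoc (incl _ _)]
          exact (h3 _).add_right (((h3 _).mul_right h1).add_right ((h3 _).mul_right h2))

/-! ### Construction of Ocneanu's trace -/

/-- The span of the elements `a σ_n b` of `ℋ_{n+1}` with `a`, `b` in `ℋ_n`. -/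
noncomputable def lastSpan (m : ℕ) : Submodule ℤ[X] (Hecke (m + 1)) :=
  Submodule.span ℤ[X]
    (Set.range fun p : Hecke m × Hecke m => incl m p.1 * gen (Fin.last m) * incl m p.2)

theorem mul_gen_last_mul_mem_lastSpan {m : ℕ} (a b : Hecke m) :
    incl m a * gen (Fin.last m) * incl m b ∈ lastSpan m :=
  Submodule.subset_span ⟨(a, b), rfl⟩

theorem gen_last_mem_lastSpan (m : ℕ) : gen (Fin.last m) ∈ lastSpan m := by
  simpa using mul_gen_last_mul_mem_lastSpan (m := m) 1 1

theorem gen_last_mul_incl_mul_gen_last_mem {m : ℕ} {y : Hecke (m + 1)} (hy : y ∈ lastSpan m) :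
    gen (Fin.last (m + 1)) * incl (m + 1) y * gen (Fin.last (m + 1)) ∈ lastSpan (m + 1) := by
  induction hy using Submodule.span_induction with
  | mem y hy =>
    obtain ⟨⟨a, c⟩, rfl⟩ := hy
    have h1 := commute_incl_incl_gen_last a
    have h2 := commute_incl_incl_gen_last c
    have hb := gen_braid (i := (Fin.last m).castSucc) (j := Fin.last (m + 1)) (by simp)
    have h3 := mul_gen_last_mul_mem_lastSpan (incl m a * gen (Fin.last m))
      (gen (Fin.last m) * incl m c)
    convert h3 using 1
    simp only [map_mul, incl_gen]
    generalize incl (m + 1) (incl m a) = a' at *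
    generalize incl (m + 1) (incl m c) = c' at *
    generalize gen (Fin.last m).castSucc = x at *
    generalize gen (Fin.last (m + 1)) = y at *
    calc y * (a' * x * c') * y = y * a' * x * (c' * y) := by simp only [mul_assoc]
      _ = a' * (y * x * y) * c' := by rw [← h1.eq, h2.eq]; simp only [mul_assoc]
      _ = _ := by rw [← hb]; simp only [mul_assoc]
  | zero => rw [map_zero, mul_zero, zero_mul]; exact zero_mem _
  | add y y' _ _ hy hy' => rw [map_add, mul_add, add_mul]; exact add_mem hy hy'
  | smul r y _ hy =>
    rw [map_smul, mul_smul_comm, smul_mul_assoc]; exact Submodule.smul_mem _ _ hy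

theorem jucysMurphy_mem_lastSpan (m : ℕ) : jucysMurphy (m + 1) ∈ lastSpan m := by
  induction m with
  | zero =>
    rw [jucysMurphy_one]
    exact gen_last_mem_lastSpan 0
  | succ m ih =>
    rw [jucysMurphy_succ]
    exact add_mem (gen_last_mul_incl_mul_gen_last_mem ih) (gen_last_mem_lastSpan _)

theorem tau_incl_mul_of_mem_lastSpan {m : ℕ} (w : Hecke m) {y : Hecke (m + 1)}
    (hy : y ∈ lastSpan m) : tau (m + 1) (incl m w * y) = 0 := by
  induction hy using Submodule.span_induction with
  | mem y hy =>
    obtain ⟨⟨a, c⟩, rfl⟩ := hy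
    rw [← mul_assoc, tau_mul_comm, ← mul_assoc, ← mul_assoc, ← map_mul, ← map_mul,
      tau_incl_mul_gen_last]
  | zero => rw [mul_zero, map_zero]
  | add y y' _ _ hy hy' => rw [mul_add, map_add, hy, hy', add_zero]
  | smul r y _ hy => rw [mul_smul_comm, map_smul, hy, smul_zero]

/-- The quadratic relation expands `σ_n L_{n+1}` as `L_n σ_n + 1 + z L_{n+1}`; `τ` kills every term
except the `1`. -/
theorem tau_incl_mul_gen_last_mul_jucysMurphy {m : ℕ} (y : Hecke m) :
    tau (m + 1) (incl m y * gen (Fin.last m) * jucysMurphy (m + 1)) = tau m y := by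
  have h : gen (Fin.last m) * jucysMurphy (m + 1) =
      incl m (jucysMurphy m) * gen (Fin.last m) + (1 + (X : ℤ[X]) • jucysMurphy (m + 1)) := by
    rw [jucysMurphy_succ, mul_add, mul_assoc _ (incl m _), ← mul_assoc, gen_mul_self, add_mul,
      one_mul, smul_mul_assoc, smul_add]
    abel
  rw [mul_assoc, h, mul_add, mul_add, map_add, map_add, ← mul_assoc, ← map_mul,
    tau_incl_mul_gen_last, zero_add, mul_one, tau_incl,
    tau_incl_mul_of_mem_lastSpan _ (Submodule.smul_mem _ _ (jucysMurphy_mem_lastSpan m)), add_zero]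

/-- The construction of Ocneanu's trace from the canonical trace and the Jucys–Murphy elements. -/
noncomputable def jmTrace (m : ℕ) : Hecke m →ₗ[ℤ[X]] ℤ[X][X] :=
  ∑ k ∈ Finset.range (m + 1),
    (Polynomial.monomial k).comp ((tau m).comp (LinearMap.mulRight ℤ[X] (jmSymm m k)))

theorem coeff_jmTrace {m : ℕ} (h : Hecke m) (k : ℕ) :
    (jmTrace m h).coeff k = tau m (h * jmSymm m k) := by
  simp only [jmTrace, LinearMap.sum_apply, LinearMap.comp_apply, LinearMap.mulRight_apply,
    Polynomial.finsetSum_coeff, Polynomial.coeff_monomial, Finset.sum_ite_eq', Finset.mem_range]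
  split_ifs with hk
  · rfl
  · rw [jmSymm_of_lt (by omega), mul_zero, map_zero]

theorem isOcneanuTrace_jmTrace : IsOcneanuTrace jmTrace where
  map_one m := by
    ext1 k
    rw [coeff_jmTrace, one_mul, Polynomial.coeff_one]
    cases k with
    | zero => rw [jmSymm_zero, tau_one, if_pos rfl]
    | succ k =>
      rw [if_neg k.succ_ne_zero]
      induction m with
      | zero => rw [jmSymm_of_lt k.succ_pos, map_zero]
      | succ m ih =>
        rw [jmSymm_succ_succ, map_add, tau_incl, ih,
          tau_incl_mul_of_mem_lastSpan _ (jucysMurphy_mem_lastSpan m), add_zero]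
  map_mul_comm m x y := by
    ext1 k
    rw [coeff_jmTrace, coeff_jmTrace, mul_assoc, (commute_jmSymm k y).eq, ← mul_assoc,
      tau_mul_comm, ← mul_assoc]
  map_addStrand m β := by
    ext1 k
    rw [coeff_jmTrace, coeff_jmTrace, ← incl_toHecke]
    cases k with
    | zero => rw [jmSymm_zero, jmSymm_zero, mul_one, mul_one, tau_incl]
    | succ k =>
      rw [jmSymm_succ_succ, mul_add, map_add, ← map_mul, ← mul_assoc, ← map_mul, tau_incl,
        tau_incl_mul_of_mem_lastSpan _ (jucysMurphy_mem_lastSpan m), add_zero]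
  markov m β := by
    ext1 k
    rw [coeff_jmTrace, map_mul toHecke, ← incl_toHecke, ← gen]
    cases k with
    | zero => rw [jmSymm_zero, mul_one, tau_incl_mul_gen_last, Polynomial.coeff_X_mul_zero]
    | succ k =>
      -- In `e_{k+1} + e_k L` the first summand times `σ_n` has trace zero, and in the second `L`
      -- absorbs `σ_n`; the drop in index is multiplication by `T`.
      rw [Polynomial.coeff_X_mul, coeff_jmTrace, jmSymm_succ_succ, mul_add, map_add, tau_mul_comm,
        ← mul_assoc, ← map_mul, tau_incl_mul_gen_last, zero_add,
        (commute_incl_jucysMurphy (jmSymm m k)).eq, ← mul_assoc, tau_mul_comm, ← mul_assoc,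
        ← mul_assoc, ← map_mul, tau_incl_mul_gen_last_mul_jucysMurphy, tau_mul_comm]

/-- This bound keeps the exponent of `1 - v²` nonnegative in the Homfly polynomial. -/
theorem natDegree_jmTrace_lt {m : ℕ} (h : Hecke m) : (jmTrace m h).natDegree < m + 1 := by
  rw [Nat.lt_succ_iff, Polynomial.natDegree_le_iff_coeff_eq_zero]
  intro k hk
  rw [coeff_jmTrace, jmSymm_of_lt hk, mul_zero, map_zero]

/-! ### Spanning sets of the Hecke algebra -/

theorem exists_eq_algebraMap (h : Hecke 0) : ∃ r : ℤ[X], h = algebraMap ℤ[X] (Hecke 0) r := by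
  refine hecke_gen_induction (p := fun h => ∃ r, h = algebraMap ℤ[X] (Hecke 0) r)
    (fun i => i.elim0) (fun r => ⟨r, rfl⟩) ?_ ?_ h
  · rintro _ _ ⟨r, rfl⟩ ⟨s, rfl⟩; exact ⟨r + s, (map_add _ _ _).symm⟩
  · rintro _ _ ⟨r, rfl⟩ ⟨s, rfl⟩; exact ⟨r * s, (map_mul _ _ _).symm⟩

theorem incl_mul_mem_lastSpan {m : ℕ} (w : Hecke m) {y : Hecke (m + 1)} (hy : y ∈ lastSpan m) :
    incl m w * y ∈ lastSpan m := by
  induction hy using Submodule.span_induction with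
  | mem y hy =>
    obtain ⟨⟨a, c⟩, rfl⟩ := hy
    rw [← mul_assoc, ← mul_assoc, ← map_mul]
    exact mul_gen_last_mul_mem_lastSpan _ _
  | zero => rw [mul_zero]; exact zero_mem _
  | add y y' _ _ hy hy' => rw [mul_add]; exact add_mem hy hy'
  | smul r y _ hy => rw [mul_smul_comm]; exact Submodule.smul_mem _ _ hy

theorem mul_incl_mem_lastSpan {m : ℕ} (w : Hecke m) {y : Hecke (m + 1)} (hy : y ∈ lastSpan m) :
    y * incl m w ∈ lastSpan m := by
  induction hy using Submodule.span_induction with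
  | mem y hy =>
    obtain ⟨⟨a, c⟩, rfl⟩ := hy
    rw [mul_assoc, ← map_mul]
    exact mul_gen_last_mul_mem_lastSpan _ _
  | zero => rw [zero_mul]; exact zero_mem _
  | add y y' _ _ hy hy' => rw [add_mul]; exact add_mem hy hy'
  | smul r y _ hy => rw [smul_mul_assoc]; exact Submodule.smul_mem _ _ hy

/-- The Hecke algebra `ℋ_{n+1}` is the sum of `ℋ_n` and `ℋ_n σ_n ℋ_n`. -/
theorem range_incl_sup_lastSpan (m : ℕ) :
    LinearMap.range (incl m).toLinearMap ⊔ lastSpan m = ⊤ := by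
  have hι : ∀ {m : ℕ} (a : Hecke m),
      incl m a ∈ LinearMap.range (incl m).toLinearMap ⊔ lastSpan m :=
    fun a => Submodule.mem_sup_left ⟨a, rfl⟩
  have hL : ∀ {m : ℕ} {y : Hecke (m + 1)}, y ∈ lastSpan m →
      y ∈ LinearMap.range (incl m).toLinearMap ⊔ lastSpan m :=
    fun hy => Submodule.mem_sup_right hy
  induction m with
  | zero =>
    refine eq_top_iff.2 fun h _ => ?_
    have hS : ∀ h : Hecke 1, ∃ r s : ℤ[X], h = r • 1 + s • gen (Fin.last 0) := by
      refine hecke_gen_induction ?_ (fun r => ⟨r, 0, by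
        rw [zero_smul, add_zero, Algebra.algebraMap_eq_smul_one]⟩) ?_ ?_
      · intro i
        exact ⟨0, 1, by rw [zero_smul, zero_add, one_smul, Subsingleton.elim i (Fin.last 0)]⟩
      · rintro _ _ ⟨r, s, rfl⟩ ⟨r', s', rfl⟩
        exact ⟨r + r', s + s', by rw [add_smul, add_smul]; abel⟩
      · rintro _ _ ⟨r, s, rfl⟩ ⟨r', s', rfl⟩
        refine ⟨r * r' + s * s', r * s' + s * r' + s * s' * X, ?_⟩
        simp only [add_mul, mul_add, smul_mul_assoc, mul_smul_comm, one_mul, mul_one,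
          gen_mul_self, smul_add, add_smul, smul_smul]
        ring_nf
        abel
    obtain ⟨r, s, rfl⟩ := hS h
    refine add_mem ?_ (hL (Submodule.smul_mem _ _ (gen_last_mem_lastSpan 0)))
    rw [← map_one (incl 0), ← map_smul]
    exact hι _
  | succ m ih =>
    -- Closure under right multiplication by `σ_n` reduces to `σ_n b σ_n`. The part of `b` from two
    -- levels down commutes with `σ_n`, leaving `σ_n²`; the other part is handled by the braid
    -- relation.
    have key : ∀ b : Hecke (m + 1), gen (Fin.last (m + 1)) * incl (m + 1) b *
        gen (Fin.last (m + 1)) ∈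
          LinearMap.range (incl (m + 1)).toLinearMap ⊔ lastSpan (m + 1) := by
      intro b
      have hb : b ∈ LinearMap.range (incl m).toLinearMap ⊔ lastSpan m := by rw [ih]; trivial
      obtain ⟨_, ⟨c, rfl⟩, y, hy, rfl⟩ := Submodule.mem_sup.1 hb
      rw [map_add, mul_add, add_mul]
      refine add_mem ?_ (hL ?_)
      · rw [AlgHom.toLinearMap_apply, ← (commute_incl_incl_gen_last c).eq, mul_assoc,
          gen_mul_self, mul_add, mul_one, mul_smul_comm]
        exact add_mem (hι _) (hL (Submodule.smul_mem _ _
          (incl_mul_mem_lastSpan _ (gen_last_mem_lastSpan _))))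
      · exact gen_last_mul_incl_mul_gen_last_mem hy
    have hgen : ∀ (i : Fin (m + 2)) (y : Hecke (m + 2)),
        y ∈ LinearMap.range (incl (m + 1)).toLinearMap ⊔ lastSpan (m + 1) →
        y * gen i ∈ LinearMap.range (incl (m + 1)).toLinearMap ⊔ lastSpan (m + 1) := by
      intro i y hy
      obtain ⟨_, ⟨c, rfl⟩, y', hy', rfl⟩ := Submodule.mem_sup.1 hy
      rw [add_mul, AlgHom.toLinearMap_apply]
      induction i using Fin.lastCases with
      | cast i =>
        rw [← incl_gen, ← map_mul]
        exact add_mem (hι _) (hL (mul_incl_mem_lastSpan _ hy'))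
      | last =>
        refine add_mem (hL (incl_mul_mem_lastSpan _ (gen_last_mem_lastSpan _))) ?_
        clear hy
        induction hy' using Submodule.span_induction with
        | mem y hy =>
          obtain ⟨⟨a, b⟩, rfl⟩ := hy
          obtain ⟨_, ⟨c', rfl⟩, y', hy', h'⟩ := Submodule.mem_sup.1 (key b)
          rw [mul_assoc, mul_assoc, ← mul_assoc (gen _), ← h', mul_add, AlgHom.toLinearMap_apply,
            ← map_mul]
          exact add_mem (hι _) (hL (incl_mul_mem_lastSpan _ hy'))
        | zero => rw [zero_mul]; exact zero_mem _
        | add y y' _ _ hy hy' => rw [add_mul]; exact add_mem hy hy'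
        | smul r y _ hy => rw [smul_mul_assoc]; exact Submodule.smul_mem _ _ hy
    refine eq_top_iff.2 fun h _ => ?_
    have hmul : ∀ h y : Hecke (m + 2),
        y ∈ LinearMap.range (incl (m + 1)).toLinearMap ⊔ lastSpan (m + 1) →
        y * h ∈ LinearMap.range (incl (m + 1)).toLinearMap ⊔ lastSpan (m + 1) := by
      refine hecke_gen_induction hgen ?_ ?_ ?_
      · intro r y hy
        rw [← Algebra.commutes, ← Algebra.smul_def]; exact Submodule.smul_mem _ _ hy
      · intro a b ha hb y hy; rw [mul_add]; exact add_mem (ha y hy) (hb y hy)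
      · intro a b ha hb y hy; rw [← mul_assoc]; exact hb _ (ha y hy)
    simpa using hmul h 1 (by rw [← map_one (incl (m + 1))]; exact hι 1)

/-- Each element of `ℋ_{n+1}` is a combination of `n + 1` coset representatives with
coefficients in `ℋ_n`. -/
theorem exists_coset_span (m : ℕ) : ∃ c : Fin (m + 2) → Hecke (m + 1),
    Submodule.span ℤ[X] (Set.range fun p : Hecke m × Fin (m + 2) => incl m p.1 * c p.2) = ⊤ := by
  induction m with
  | zero =>
    refine ⟨![1, gen (Fin.last 0)], ?_⟩
    rw [eq_top_iff, ← range_incl_sup_lastSpan]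
    refine sup_le ?_ (Submodule.span_le.2 ?_)
    · rintro _ ⟨a, rfl⟩
      exact Submodule.subset_span ⟨(a, 0), by simp⟩
    · rintro _ ⟨⟨a, b⟩, rfl⟩
      obtain ⟨r, rfl⟩ := exists_eq_algebraMap b
      refine Submodule.subset_span ⟨(a * algebraMap _ _ r, 1), ?_⟩
      simp [mul_assoc, Algebra.commutes]
  | succ m ih =>
    obtain ⟨c, hc⟩ := ih
    refine ⟨Fin.cons 1 fun k => gen (Fin.last (m + 1)) * incl (m + 1) (c k), ?_⟩
    rw [eq_top_iff, ← range_incl_sup_lastSpan]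
    refine sup_le ?_ (Submodule.span_le.2 ?_)
    · rintro _ ⟨a, rfl⟩
      exact Submodule.subset_span ⟨(a, 0), by simp⟩
    · rintro _ ⟨⟨a, b⟩, rfl⟩
      have hb : b ∈ Submodule.span ℤ[X]
          (Set.range fun p : Hecke m × Fin (m + 2) => incl m p.1 * c p.2) := by rw [hc]; trivial
      rw [SetLike.mem_coe]
      dsimp only
      induction hb using Submodule.span_induction with
      | mem b hb =>
        obtain ⟨⟨d, k⟩, rfl⟩ := hb
        refine Submodule.subset_span ⟨(a * incl m d, k.succ), ?_⟩
        simp only [map_mul, Fin.cons_succ, mul_assoc]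
        rw [← mul_assoc (incl _ (incl _ d)), (commute_incl_incl_gen_last d).eq, mul_assoc]
      | zero => rw [map_zero, mul_zero]; exact zero_mem _
      | add y y' _ _ hy hy' => rw [map_add, mul_add]; exact add_mem hy hy'
      | smul r y _ hy => rw [map_smul, mul_smul_comm]; exact Submodule.smul_mem _ _ hy

/-- The Hecke algebra is spanned by a family that is indexed by the symmetric group. -/
theorem exists_perm_span (m : ℕ) : ∃ e : Equiv.Perm (Fin (m + 1)) → Hecke m,
    Submodule.span ℤ[X] (Set.range e) = ⊤ := by
  induction m with
  | zero =>
    refine ⟨fun _ => 1, eq_top_iff.2 fun h _ => ?_⟩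
    obtain ⟨r, rfl⟩ := exists_eq_algebraMap h
    rw [Algebra.algebraMap_eq_smul_one]
    exact Submodule.smul_mem _ _ (Submodule.subset_span ⟨1, rfl⟩)
  | succ m ih =>
    obtain ⟨e, he⟩ := ih
    obtain ⟨c, hc⟩ := exists_coset_span m
    -- Only a bijection of `S_{n+1}` with `Fin (n + 1) × S_n` is needed, to count the spanning
    -- family; it need not match braids with their permutations.
    refine ⟨fun π => incl m (e (Equiv.Perm.decomposeFin π).2) * c (Equiv.Perm.decomposeFin π).1, ?_⟩
    rw [eq_top_iff, ← hc, Submodule.span_le]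
    rintro _ ⟨⟨a, k⟩, rfl⟩
    have ha : a ∈ Submodule.span ℤ[X] (Set.range e) := by rw [he]; trivial
    rw [SetLike.mem_coe]
    dsimp only
    induction ha using Submodule.span_induction with
    | mem a ha =>
      obtain ⟨π, rfl⟩ := ha
      exact Submodule.subset_span ⟨Equiv.Perm.decomposeFin.symm (k, π), by
        simp only [Equiv.apply_symm_apply]⟩
    | zero => rw [map_zero, zero_mul]; exact zero_mem _
    | add y y' _ _ hy hy' => rw [map_add, add_mul]; exact add_mem hy hy'
    | smul r y _ hy => rw [map_smul, smul_mul_assoc]; exact Submodule.smul_mem _ _ hy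

theorem toPermFun_surjective (m : ℕ) : Function.Surjective (toPermFun m) := by
  intro f
  choose ω hω using exists_isPositivePermutationBraid (m := m)
  refine ⟨∑ π, f π • toHecke (ω π), ?_⟩
  rw [map_sum]
  ext1 u
  simp [map_smul, toPermFun_of_isPositivePermutationBraid (hω _), delta_apply]

/-- Composed with a spanning family of `n!` elements, the map becomes a surjective endomorphism of a
finite free module over a commutative ring, hence injective. -/
theorem toPermFun_bijective (m : ℕ) : Function.Bijective (toPermFun m) := by
  refine ⟨?_, toPermFun_surjective m⟩
  obtain ⟨e, he⟩ := exists_perm_span m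
  have hF : Function.Surjective (Fintype.linearCombination ℤ[X] e) := by
    rw [← LinearMap.range_eq_top, Fintype.range_linearCombination, he]
  have hinj := OrzechProperty.injective_of_surjective_endomorphism
    ((toPermFun m).comp (Fintype.linearCombination ℤ[X] e)) ((toPermFun_surjective m).comp hF)
  intro x y hxy
  obtain ⟨f, rfl⟩ := hF x
  obtain ⟨g, rfl⟩ := hF y
  rw [hinj hxy]

/-! ### Uniqueness of Ocneanu's trace -/

theorem IsOcneanuTrace.map_incl {Tr : ∀ m : ℕ, Hecke m →ₗ[ℤ[X]] ℤ[X][X]} (hTr : IsOcneanuTrace Tr)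
    {m : ℕ} (h : Hecke m) : Tr (m + 1) (incl m h) = Tr m h := by
  refine hecke_induction (p := fun h => Tr (m + 1) (incl m h) = Tr m h) ?_ ?_ ?_ h
  · intro β; rw [incl_toHecke, hTr.map_addStrand]
  · intro a b ha hb; rw [map_add, map_add, map_add, ha, hb]
  · intro r a ha; rw [map_smul, map_smul, map_smul, ha]

theorem IsOcneanuTrace.map_incl_mul_gen {Tr : ∀ m : ℕ, Hecke m →ₗ[ℤ[X]] ℤ[X][X]}
    (hTr : IsOcneanuTrace Tr) {m : ℕ} (h : Hecke m) :
    Tr (m + 1) (incl m h * gen (Fin.last m)) = X * Tr m h := by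
  refine hecke_induction (p := fun h => Tr (m + 1) (incl m h * gen (Fin.last m)) = X * Tr m h)
    ?_ ?_ ?_ h
  · intro β; rw [incl_toHecke, gen, ← map_mul, hTr.markov]
  · intro a b ha hb; rw [map_add, add_mul, map_add, map_add, ha, hb, mul_add]
  · intro r a ha; rw [map_smul, smul_mul_assoc, map_smul, map_smul, ha, mul_smul_comm]

theorem IsOcneanuTrace.unique {Tr Tr' : ∀ m : ℕ, Hecke m →ₗ[ℤ[X]] ℤ[X][X]}
    (hTr : IsOcneanuTrace Tr) (hTr' : IsOcneanuTrace Tr') : Tr = Tr' := by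
  funext m
  induction m with
  | zero =>
    ext1 h
    obtain ⟨r, rfl⟩ := exists_eq_algebraMap h
    rw [Algebra.algebraMap_eq_smul_one, map_smul, map_smul, hTr.map_one, hTr'.map_one]
  | succ m ih =>
    rw [← LinearMap.eqLocus_eq_top, eq_top_iff, ← range_incl_sup_lastSpan]
    refine sup_le ?_ (Submodule.span_le.2 ?_)
    · rintro _ ⟨a, rfl⟩
      rw [LinearMap.mem_eqLocus, AlgHom.toLinearMap_apply, hTr.map_incl, hTr'.map_incl, ih]
    · rintro _ ⟨⟨a, b⟩, rfl⟩
      rw [SetLike.mem_coe, LinearMap.mem_eqLocus, hTr.map_mul_comm, hTr'.map_mul_comm,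
        ← mul_assoc, ← map_mul, hTr.map_incl_mul_gen, hTr'.map_incl_mul_gen, ih]

/-- Existence and uniqueness together rule out the default value `0`. -/
theorem ocneanuTrace_eq_jmTrace (m : ℕ) : ocneanuTrace m = jmTrace m := by
  have h : ∃! Tr : ∀ m : ℕ, Hecke m →ₗ[ℤ[X]] ℤ[X][X], IsOcneanuTrace Tr :=
    ⟨jmTrace, isOcneanuTrace_jmTrace, fun _ hTr => hTr.unique isOcneanuTrace_jmTrace⟩
  rw [ocneanuTrace, dif_pos h, h.choose_spec.1.unique isOcneanuTrace_jmTrace]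

/-! ### The right inner product -/

theorem z_ne_zero : z ≠ 0 := by
  rw [z, map_ne_zero_iff _ (IsFractionRing.injective ℤ[X] Kz)]
  exact X_ne_zero

theorem v_ne_zero : v ≠ 0 := HahnSeries.single_ne_zero one_ne_zero

theorem one_sub_v_sq_pow (j : ℕ) : (1 - v ^ 2) ^ j =
    HahnSeries.ofPowerSeries ℤ Kz (((1 - X ^ 2) ^ j : Kz[X]) : PowerSeries Kz) := by
  simp [v, HahnSeries.ofPowerSeries_X]

theorem one_sub_v_sq_ne_zero : (1 - v ^ 2 : LaurentSeries Kz) ≠ 0 := by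
  have h := one_sub_v_sq_pow 1
  rw [pow_one, pow_one] at h
  rw [h, map_ne_zero_iff _ HahnSeries.ofPowerSeries_injective]
  intro h0
  have := congrArg (PowerSeries.coeff 0) h0
  simp at this

theorem coeff_one_sub_sq_pow {j m : ℕ} (hj : j ≤ m) :
    ((1 - X ^ 2) ^ j : Kz[X]).coeff (2 * m) = if j = m then (-1) ^ m else 0 := by
  have hd : (1 - X ^ 2 : Kz[X]).natDegree ≤ 2 := by compute_degree
  split_ifs with h
  · rw [← h, mul_comm, coeff_pow_of_natDegree_le hd]
    simp [coeff_one]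
  · refine coeff_eq_zero_of_natDegree_lt ((natDegree_pow_le_of_le j hd).trans_lt ?_)
    omega

/-- The term equals `v^{-m} (t / z^{m-k}) (1 - v²)^{m-k}`, whose top exponent `m - 2k` reaches `m`
only for `k = 0`. -/
theorem coeff_homfly_term {m k : ℕ} (hk : k ≤ m) (t : Kz) :
    (((v⁻¹ - v) / HahnSeries.C z) ^ m *
      (HahnSeries.C t * (HahnSeries.C z / (1 - v ^ 2)) ^ k) : LaurentSeries Kz).coeff (m : ℤ) =
    if k = 0 then t * (-1) ^ m / z ^ m else 0 := by
  have hz : (HahnSeries.C z : LaurentSeries Kz) ≠ 0 := by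
    rw [map_ne_zero_iff _ HahnSeries.C_injective]; exact z_ne_zero
  have hv := v_ne_zero
  have hv2 := one_sub_v_sq_ne_zero
  have h1 : (v⁻¹ - v : LaurentSeries Kz) = v⁻¹ * (1 - v ^ 2) := by
    field_simp
  obtain ⟨j, rfl⟩ := Nat.exists_eq_add_of_le hk
  have h2 : ((v⁻¹ - v) / HahnSeries.C z) ^ (k + j) *
      (HahnSeries.C t * (HahnSeries.C z / (1 - v ^ 2)) ^ k) =
      v⁻¹ ^ (k + j) * (HahnSeries.C (t / z ^ j) * (1 - v ^ 2) ^ j) := by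
    rw [h1, map_div₀, map_pow]
    generalize v⁻¹ = a
    generalize 1 - v ^ 2 = u at hv2
    simp only [div_pow, mul_pow, pow_add]
    field_simp
  have h3 : (v⁻¹ ^ (k + j) : LaurentSeries Kz) = HahnSeries.single (-((k + j : ℕ) : ℤ)) 1 := by
    rw [v, HahnSeries.inv_single, HahnSeries.single_pow]
    simp
  rw [h2, h3, HahnSeries.coeff_single_mul, one_mul, HahnSeries.C_mul_eq_smul,
    HahnSeries.coeff_smul, one_sub_v_sq_pow,
    show ((k + j : ℕ) : ℤ) - -((k + j : ℕ) : ℤ) = ((2 * (k + j) : ℕ) : ℤ) by push_cast; ring,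
    LaurentSeries.coeff_coe_powerSeries, Polynomial.coeff_coe,
    coeff_one_sub_sq_pow (Nat.le_add_left j k)]
  by_cases h0 : k = 0
  · subst h0; simp; ring
  · simp [h0]

theorem rightInner_eq_tau {m : ℕ} (α β : BraidGroup m) :
    rightInner α β = algebraMap ℤ[X] Kz (tau m (toHecke (α * rev β))) := by
  rw [rightInner, framedHomfly, ocneanuTrace_eq_jmTrace,
    eval₂_eq_sum_range' _ (natDegree_jmTrace_lt _), Finset.mul_sum, HahnSeries.coeff_sum]
  simp only [RingHom.comp_apply]
  rw [Finset.sum_congr rfl fun k hk => coeff_homfly_term (Finset.mem_range_succ_iff.1 hk) _,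
    Finset.sum_ite_eq' _ 0, if_pos (Finset.mem_range.2 m.succ_pos), coeff_jmTrace, jmSymm_zero,
    mul_one, neg_pow]
  have hz := z_ne_zero
  field_simp
  rw [← pow_mul, mul_comm m, pow_mul]
  simp

theorem rightInner_eq_dotProduct {m : ℕ} (α β : BraidGroup m) : rightInner α β =
    algebraMap ℤ[X] Kz (toPermFun m (toHecke α) ⬝ᵥ toPermFun m (toHecke β)) := by
  rw [rightInner_eq_tau, map_mul, tau_mul_toHecke_rev]

end BraidHecke

theorem mainTheorem3 (m : ℕ) (ω : Equiv.Perm (Fin (m + 1)) → BraidGroup m)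
    (hω : ∀ π, IsPositivePermutationBraid π (ω π)) :
    (∃ b : Module.Basis (Equiv.Perm (Fin (m + 1))) ℤ[X] (Hecke m), ∀ π, b π = toHecke (ω π)) ∧
    (∃! B : Hecke m →ₗ[ℤ[X]] Hecke m →ₗ[ℤ[X]] ℤ[X], ExtendsRightInner B) ∧
    (∀ π κ, rightInner (ω π) (ω κ) = if π = κ then 1 else 0) := by
  have hδ := fun π => toPermFun_of_isPositivePermutationBraid (hω π)
  refine ⟨?_, ?_, ?_⟩
  · refine ⟨Module.Basis.ofEquivFun (LinearEquiv.ofBijective _ (toPermFun_bijective m)),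
      fun π => ?_⟩
    rw [Module.Basis.coe_ofEquivFun, LinearEquiv.symm_apply_eq, LinearEquiv.ofBijective_apply, hδ]
    rfl
  · refine ⟨(dotProductBilin ℤ[X] ℤ[X]).compl₁₂ (toPermFun m) (toPermFun m), ?_, ?_⟩
    · intro α β
      rw [rightInner_eq_dotProduct]
      rfl
    · intro B hB
      refine LinearMap.ext₂ fun x y => ?_
      refine hecke_induction (p := fun x => B x y = toPermFun m x ⬝ᵥ toPermFun m y) ?_ ?_ ?_ x
      · intro α
        refine hecke_induction
          (p := fun y => B (toHecke α) y = toPermFun m (toHecke α) ⬝ᵥ toPermFun m y) ?_ ?_ ?_ y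
        · intro β
          -- The inner product of braids is defined in the fraction field, so the two forms are
          -- compared there.
          refine IsFractionRing.injective ℤ[X] Kz ?_
          rw [hB, rightInner_eq_dotProduct]
        · intro a b ha hb; rw [map_add, map_add, ha, hb, dotProduct_add]
        · intro r a ha; rw [map_smul, map_smul, ha, dotProduct_smul]
      · intro a b ha hb; rw [map_add, map_add, LinearMap.add_apply, ha, hb, add_dotProduct]
      · intro r a ha; rw [map_smul, map_smul, LinearMap.smul_apply, ha, smul_dotProduct]
  · intro π κ
    rw [rightInner_eq_dotProduct, hδ, hδ, dotProduct_delta, delta_apply]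
    simp only [eq_comm (a := κ)]
    split_ifs <;> simp
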